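/- Let $X$ be a nonempty Tychonoff space. Let $C(X)$ be the set of continuous real-valued functions on $X$. Let $w(X)$ be the least cardinality of a base of $X$. Let $nw(X)$ be the least cardinality of a network of $X$, that is, of a family $\mathcal N$ of subsets of $X$ such that for every open $U\subseteq X$ and every $x\in U$ there is $N\in\mathcal N$ with $x\in N\subseteq U$. Let $Nag(X)$ (the Nagami number) be the least cardinality of a family $\mathcal F$ of closed subsets of the Stone–Čech compactification $\beta X$ such that for every $x\in X$ and every $y\in\beta X\setminus X$ there is $F\in\mathcal F$ with $x\in F$ and $y\notin F$. As usual for cardinal functions, each of $w(X)$, $nw(X)$ and $Nag(X)$ is understood to be $\omega$ when this least cardinality is finite. Then $$w(X)\le |C(X)|\le nw(X)^{Nag(X)}.$$ -/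

import Mathlib

open scoped Cardinal

universe u

/-- `𝒩` is a network of the space `X`: for every point `x` of an open set `U` some member of `𝒩`
contains `x` and lies in `U`. Members of a network need not be open. -/
def IsNetwork {X : Type u} [TopologicalSpace X] (𝒩 : Set (Set X)) : Prop :=
  ∀ (x : X) (U : Set X), IsOpen U → x ∈ U → ∃ N ∈ 𝒩, x ∈ N ∧ N ⊆ U

/-- The weight `w(X)`: the least cardinality of a base, rounded up to `ℵ₀` if it is finite
(cardinal functions take infinite values only, as usual). -/
noncomputable def weight (X : Type u) [TopologicalSpace X] : Cardinal.{u} :=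
  max ℵ₀ (sInf {κ | ∃ ℬ : Set (Set X), TopologicalSpace.IsTopologicalBasis ℬ ∧ #ℬ = κ})

/-- The network weight `nw(X)`: the least cardinality of a network, rounded up to `ℵ₀` if it is
finite. -/
noncomputable def networkWeight (X : Type u) [TopologicalSpace X] : Cardinal.{u} :=
  max ℵ₀ (sInf {κ | ∃ 𝒩 : Set (Set X), IsNetwork 𝒩 ∧ #𝒩 = κ})

/-- A family `ℱ` of subsets of the Stone–Čech compactification `βX` separates the points of `X`
from `βX \ X`, where `X` is identified with its image in `βX`. -/
def SeparatesFromRemainder {X : Type u} [TopologicalSpace X] (ℱ : Set (Set (StoneCech X))) :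
    Prop :=
  ∀ (x : X) (y : StoneCech X), y ∉ Set.range (stoneCechUnit : X → StoneCech X) →
    ∃ F ∈ ℱ, stoneCechUnit x ∈ F ∧ y ∉ F

/-- The Nagami number `Nag(X)`: the least cardinality of a family of closed subsets of `βX` that
separates the points of `X` from `βX \ X`, rounded up to `ℵ₀` if it is finite. -/
noncomputable def nagamiNumber (X : Type u) [TopologicalSpace X] : Cardinal.{u} :=
  max ℵ₀ (sInf {κ | ∃ ℱ : Set (Set (StoneCech X)),
    (∀ F ∈ ℱ, IsClosed F) ∧ SeparatesFromRemainder ℱ ∧ #ℱ = κ})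

/-! ### Lower bound: cozero sets -/

/-! Lower bound: the cozero sets of continuous functions form a base. Upper bound: extend `f` to `g
: βX → [-∞, ∞]`. A network gives at most `nw(X)` pairs of disjoint open sets of `βX` separating the
points of `X`. For `x` in `X`, the members of `ℱ` containing `x` intersect in a compact `K ⊆ X`, so
for rationals `b < a` a finite combination `S` of these pairs separates `{a ≤ g}` from `{g ≤ b}` on
`K`, and by compactness already on a finite intersection `G` (`exists_separatesLevels`). The map
`(G, a, b) ↦ S` determines `f` (`le_of_levelCode_eq`), and there are at most `nw(X) ^ Nag(X)` such
maps. -/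

theorem isTopologicalBasis_range_ne_zero (X : Type u) [TopologicalSpace X]
    [CompletelyRegularSpace X] :
    TopologicalSpace.IsTopologicalBasis
      (Set.range fun f : C(X, ℝ) => {x | f x ≠ 0}) := by
  refine TopologicalSpace.isTopologicalBasis_of_isOpen_of_nhds ?_ ?_
  · rintro _ ⟨f, rfl⟩
    exact isOpen_ne_fun f.continuous continuous_const
  · intro x U hx hU
    obtain ⟨f, hf, hfx, hfU⟩ := CompletelyRegularSpace.completely_regular x Uᶜ
      hU.isClosed_compl (by simpa using hx)
    refine ⟨_, ⟨⟨fun y => 1 - (f y : ℝ), by fun_prop⟩, rfl⟩, ?_, ?_⟩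
    · simp [hfx]
    · intro y hy
      by_contra hyU
      have := hfU hyU
      simp [this] at hy

theorem aleph0_le_mk_continuousMap (X : Type u) [TopologicalSpace X] [Nonempty X] :
    ℵ₀ ≤ #(C(X, ℝ)) := by
  have : Infinite C(X, ℝ) :=
    Infinite.of_injective (fun r : ℝ => ContinuousMap.const X r) fun r s h => by
      simpa using congrArg (fun g : C(X, ℝ) => g (Classical.arbitrary X)) h
  exact Cardinal.aleph0_le_mk _

theorem weight_le_mk_continuousMap (X : Type u) [TopologicalSpace X]
    [CompletelyRegularSpace X] [Nonempty X] : weight X ≤ #(C(X, ℝ)) :=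
  max_le (aleph0_le_mk_continuousMap X) <| le_trans
    (csInf_le' (Set.mem_ofPred.2 ⟨_, isTopologicalBasis_range_ne_zero X, rfl⟩)) Cardinal.mk_range_le

/-! ### Optimal families -/

theorem exists_isNetwork_mk_le (X : Type u) [TopologicalSpace X] :
    ∃ 𝒩 : Set (Set X), IsNetwork 𝒩 ∧ #𝒩 ≤ networkWeight X := by
  have hne : {κ | ∃ 𝒩 : Set (Set X), IsNetwork 𝒩 ∧ #𝒩 = κ}.Nonempty :=
    ⟨_, Set.univ, fun x U _ hx => ⟨U, trivial, hx, subset_rfl⟩, rfl⟩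
  obtain ⟨𝒩, h𝒩, hcard⟩ := csInf_mem hne
  exact ⟨𝒩, h𝒩, hcard.le.trans (le_max_right _ _)⟩

theorem exists_separatesFromRemainder_mk_le (X : Type u) [TopologicalSpace X] :
    ∃ ℱ : Set (Set (StoneCech X)), (∀ F ∈ ℱ, IsClosed F) ∧ SeparatesFromRemainder ℱ ∧
      #ℱ ≤ nagamiNumber X := by
  have hne : {κ | ∃ ℱ : Set (Set (StoneCech X)),
      (∀ F ∈ ℱ, IsClosed F) ∧ SeparatesFromRemainder ℱ ∧ #ℱ = κ}.Nonempty :=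
    ⟨_, {F | IsClosed F}, fun _ h => h, fun x y hy =>
      ⟨{stoneCechUnit x}, isClosed_singleton, rfl, fun h => hy ⟨x, h.symm⟩⟩, rfl⟩
  obtain ⟨ℱ, hcl, hsep, hcard⟩ := csInf_mem hne
  exact ⟨ℱ, hcl, hsep, hcard.le.trans (le_max_right _ _)⟩

/-! ### Separation of compact sets by finite combinations of a separating family of pairs -/

/-- Disjoint compact sets are separated by a finite union of finite intersections of the sets `U p`
and the dual combination of the sets `V p`, if the pairs `(U p, V p)` separate their points. -/
theorem exists_finset_finset_separating {Y P : Type*} [TopologicalSpace Y] {U V : P → Set Y}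
    (hU : ∀ p, IsOpen (U p)) (hV : ∀ p, IsOpen (V p)) {C D : Set Y}
    (hC : IsCompact C) (hD : IsCompact D)
    (hsep : ∀ c ∈ C, ∀ d ∈ D, ∃ p, c ∈ U p ∧ d ∈ V p) :
    ∃ S : Finset (Finset P),
      C ⊆ ⋃ s ∈ S, ⋂ p ∈ s, U p ∧ D ⊆ ⋂ s ∈ S, ⋃ p ∈ s, V p := by
  classical
  have point : ∀ c ∈ C, ∃ s : Finset P, c ∈ ⋂ p ∈ s, U p ∧ D ⊆ ⋃ p ∈ s, V p := by
    intro c hc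
    rcases D.eq_empty_or_nonempty with rfl | ⟨d₀, hd₀⟩
    · exact ⟨∅, by simp⟩
    have : Nonempty P := ⟨(hsep c hc d₀ hd₀).choose⟩
    choose! p hpU hpV using hsep c hc
    obtain ⟨t, htD, ht⟩ := hD.elim_nhds_subcover (fun d => V (p d))
      fun d hd => (hV _).mem_nhds (hpV d hd)
    refine ⟨t.image p, ?_, ?_⟩
    · simp only [Set.mem_iInter, Finset.mem_image]
      rintro _ ⟨d, hd, rfl⟩
      exact hpU d (htD d hd)
    · simpa using ht
  choose! s hsU hsV using point
  obtain ⟨t, htC, ht⟩ := hC.elim_nhds_subcover (fun c => ⋂ p ∈ s c, U p)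
    fun c hc => (isOpen_biInter_finset fun p _ => hU p).mem_nhds (hsU c hc)
  refine ⟨t.image s, by simpa using ht, ?_⟩
  simp only [Finset.mem_image, Set.subset_iInter_iff]
  rintro _ ⟨c, hc, rfl⟩
  exact hsV c (htC c hc)

theorem disjoint_biUnion_biInter_biInter_biUnion {Y P : Type*} {U V : P → Set Y}
    (hUV : ∀ p, Disjoint (U p) (V p)) (S : Finset (Finset P)) :
    Disjoint (⋃ s ∈ S, ⋂ p ∈ s, U p) (⋂ s ∈ S, ⋃ p ∈ s, V p) := by
  rw [Set.disjoint_left]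
  intro y hy hy'
  simp only [Set.mem_iUnion, Set.mem_iInter] at hy hy'
  obtain ⟨s, hs, hys⟩ := hy
  obtain ⟨p, hp, hyp⟩ := hy' s hs
  exact Set.disjoint_left.1 (hUV p) (hys p hp) hyp

/-- A network of `X` yields pairs of disjoint open sets, indexed by pairs of members of the network,
that separate the points of `X` in any Hausdorff space into which `X` is mapped injectively. -/
theorem IsNetwork.exists_disjoint_open_pairs {X : Type u} [TopologicalSpace X] {Y : Type*}
    [TopologicalSpace Y] [T2Space Y] {𝒩 : Set (Set X)} (h𝒩 : IsNetwork 𝒩) {i : X → Y}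
    (hi : Continuous i) (hinj : Function.Injective i) :
    ∃ U V : 𝒩 × 𝒩 → Set Y, (∀ p, IsOpen (U p)) ∧ (∀ p, IsOpen (V p)) ∧
      (∀ p, Disjoint (U p) (V p)) ∧ ∀ x y, x ≠ y → ∃ p, i x ∈ U p ∧ i y ∈ V p := by
  have key : ∀ p : 𝒩 × 𝒩, ∃ W : Set Y × Set Y, IsOpen W.1 ∧ IsOpen W.2 ∧ Disjoint W.1 W.2 ∧
      ((∃ A B : Set Y, IsOpen A ∧ IsOpen B ∧ Disjoint A B ∧ i '' p.1 ⊆ A ∧ i '' p.2 ⊆ B) →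
        i '' p.1 ⊆ W.1 ∧ i '' p.2 ⊆ W.2) := by
    intro p
    by_cases h : ∃ A B : Set Y, IsOpen A ∧ IsOpen B ∧ Disjoint A B ∧ i '' p.1 ⊆ A ∧ i '' p.2 ⊆ B
    · obtain ⟨A, B, hA, hB, hAB, h⟩ := h
      exact ⟨(A, B), hA, hB, hAB, fun _ => h⟩
    -- Pairs of network members without disjoint open neighbourhoods get a harmless default.
    · exact ⟨(∅, ∅), isOpen_empty, isOpen_empty, disjoint_bot_left, fun h' => (h h').elim⟩
  choose W hW₁ hW₂ hdisj hW using key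
  refine ⟨fun p => (W p).1, fun p => (W p).2, hW₁, hW₂, hdisj, fun x y hxy => ?_⟩
  obtain ⟨A, B, hA, hB, hxA, hyB, hAB⟩ := t2_separation (hinj.ne hxy)
  obtain ⟨N, hN, hxN, hNA⟩ := h𝒩 x _ (hA.preimage hi) hxA
  obtain ⟨M, hM, hyM, hMB⟩ := h𝒩 y _ (hB.preimage hi) hyB
  have := hW (⟨N, hN⟩, ⟨M, hM⟩)
    ⟨A, B, hA, hB, hAB, Set.image_subset_iff.2 hNA, Set.image_subset_iff.2 hMB⟩
  exact ⟨_, this.1 ⟨x, hxN, rfl⟩, this.2 ⟨y, hyM, rfl⟩⟩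

/-! ### Coding continuous functions -/

/-- On the intersection of `G`, the combination of the pairs `(U p, V p)` coded by `S` separates
`{a ≤ g}` from `{g ≤ b}`. -/
def SeparatesLevels {Y P : Type*} (U V : P → Set Y) {ℱ : Set (Set Y)} (g : Y → EReal)
    (k : Finset ℱ × ℚ × ℚ) (S : Finset (Finset P)) : Prop :=
  ∀ y, (∀ F ∈ k.1, y ∈ (F : Set Y)) →
    ((((k.2.1 : ℝ) : EReal) ≤ g y → y ∈ ⋃ s ∈ S, ⋂ p ∈ s, U p) ∧
      (g y ≤ ((k.2.2 : ℝ) : EReal) → y ∈ ⋂ s ∈ S, ⋃ p ∈ s, V p))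

theorem exists_separatesLevels {Y P : Type*} [TopologicalSpace Y] [CompactSpace Y]
    {U V : P → Set Y} (hU : ∀ p, IsOpen (U p)) (hV : ∀ p, IsOpen (V p)) {R : Set Y}
    (hsep : ∀ c ∈ R, ∀ d ∈ R, c ≠ d → ∃ p, c ∈ U p ∧ d ∈ V p)
    {ℱ : Set (Set Y)} (hℱ : ∀ F ∈ ℱ, IsClosed F) {x : Y}
    (hx : ∀ y ∉ R, ∃ F ∈ ℱ, x ∈ F ∧ y ∉ F) {g : Y → EReal} (hg : Continuous g) {a b : ℚ}
    (hab : b < a) :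
    ∃ G : Finset ℱ, (∀ F ∈ G, x ∈ (F : Set Y)) ∧ ∃ S, SeparatesLevels U V g (G, a, b) S := by
  classical
  set K : Set Y := ⋂ F : {F : ℱ // x ∈ (F : Set Y)}, (F : Set Y) with hK
  have hKcl : IsClosed K := isClosed_iInter fun F => hℱ _ F.1.2
  have hKR : K ⊆ R := by
    intro y hy
    by_contra hyR
    obtain ⟨F, hF, hxF, hyF⟩ := hx y hyR
    exact hyF (Set.mem_iInter.1 hy ⟨⟨F, hF⟩, hxF⟩)
  have hab' : ((b : ℝ) : EReal) < ((a : ℝ) : EReal) := by exact_mod_cast hab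
  obtain ⟨S, hSC, hSD⟩ := exists_finset_finset_separating hU hV
    (C := K ∩ {y | ((a : ℝ) : EReal) ≤ g y}) (D := K ∩ {y | g y ≤ ((b : ℝ) : EReal)})
    (hKcl.inter (isClosed_le continuous_const hg)).isCompact
    (hKcl.inter (isClosed_le hg continuous_const)).isCompact
    (fun c hc d hd => hsep c (hKR hc.1) d (hKR hd.1) fun h => by
      subst h
      exact (hc.2.trans hd.2).not_gt hab')
  have hB : IsOpen (⋃ s ∈ S, ⋂ p ∈ s, U p) :=
    isOpen_biUnion fun s _ => isOpen_biInter_finset fun p _ => hU p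
  have hB' : IsOpen (⋂ s ∈ S, ⋃ p ∈ s, V p) :=
    isOpen_biInter_finset fun s _ => isOpen_biUnion fun p _ => hV p
  -- `W` is the set of points where both implications of `SeparatesLevels` hold. It is open and
  -- contains `K`, so finitely many of the closed sets defining `K` already intersect inside it.
  set W : Set Y := ((⋃ s ∈ S, ⋂ p ∈ s, U p) ∪ {y | g y < ((a : ℝ) : EReal)}) ∩
    ((⋂ s ∈ S, ⋃ p ∈ s, V p) ∪ {y | ((b : ℝ) : EReal) < g y}) with hWdef
  have hW : IsOpen W := (hB.union (isOpen_lt hg continuous_const)).inter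
    (hB'.union (isOpen_lt continuous_const hg))
  have hKW : K ⊆ W := by
    intro y hy
    refine ⟨?_, ?_⟩
    · rcases lt_or_ge (g y) ((a : ℝ) : EReal) with h | h
      · exact Or.inr h
      · exact Or.inl (hSC ⟨hy, h⟩)
    · rcases lt_or_ge ((b : ℝ) : EReal) (g y) with h | h
      · exact Or.inr h
      · exact Or.inl (hSD ⟨hy, h⟩)
  obtain ⟨t, ht⟩ := hW.isClosed_compl.isCompact.elim_finite_subfamily_closed
    (fun F : {F : ℱ // x ∈ (F : Set Y)} => (F : Set Y)) (fun F => hℱ _ F.1.2)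
    (Set.disjoint_iff_inter_eq_empty.1 (Set.disjoint_compl_left_iff_subset.2 hKW))
  refine ⟨t.image Subtype.val, ?_, S, fun y hy => ?_⟩
  · simp only [Finset.mem_image]
    rintro _ ⟨F, -, rfl⟩
    exact F.2
  · have hyW : y ∈ W := by
      by_contra hyW
      have : y ∈ Wᶜ ∩ ⋂ F ∈ t, ((F : ℱ) : Set Y) :=
        ⟨hyW, Set.mem_iInter₂.2 fun F hF => hy F (Finset.mem_image_of_mem _ hF)⟩
      rw [ht] at this
      exact this
    exact ⟨fun h => hyW.1.resolve_right h.not_gt, fun h => hyW.2.resolve_right h.not_gt⟩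

open Classical in
/-- A set of codes separating the levels of `g` over `k`, if there is one. -/
noncomputable def levelCode {Y P : Type*} (U V : P → Set Y) {ℱ : Set (Set Y)} (g : Y → EReal)
    (k : Finset ℱ × ℚ × ℚ) : Option (Finset (Finset P)) :=
  if h : ∃ S, SeparatesLevels U V g k S then some h.choose else none

theorem separatesLevels_of_levelCode_eq_some {Y P : Type*} {U V : P → Set Y} {ℱ : Set (Set Y)}
    {g : Y → EReal} {k : Finset ℱ × ℚ × ℚ} {S : Finset (Finset P)}
    (h : levelCode U V g k = some S) : SeparatesLevels U V g k S := by
  unfold levelCode at h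
  split_ifs at h with h'
  rw [← Option.some.inj h]
  exact h'.choose_spec

theorem exists_levelCode_eq_some {Y P : Type*} {U V : P → Set Y} {ℱ : Set (Set Y)}
    {g : Y → EReal} {k : Finset ℱ × ℚ × ℚ} (h : ∃ S, SeparatesLevels U V g k S) :
    ∃ S, levelCode U V g k = some S :=
  ⟨h.choose, dif_pos h⟩

/-- If `g x < b < a < f x`, a common code `S` would put `x` in both of two disjoint sets: the `U`
side because `a ≤ f x`, the `V` side because `g x ≤ b`. -/
theorem le_of_levelCode_eq {Y P : Type*} [TopologicalSpace Y] [CompactSpace Y]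
    {U V : P → Set Y} (hU : ∀ p, IsOpen (U p)) (hV : ∀ p, IsOpen (V p))
    (hUV : ∀ p, Disjoint (U p) (V p)) {R : Set Y}
    (hsep : ∀ c ∈ R, ∀ d ∈ R, c ≠ d → ∃ p, c ∈ U p ∧ d ∈ V p)
    {ℱ : Set (Set Y)} (hℱ : ∀ F ∈ ℱ, IsClosed F) {x : Y}
    (hx : ∀ y ∉ R, ∃ F ∈ ℱ, x ∈ F ∧ y ∉ F) {f g : Y → EReal} (hf : Continuous f)
    (h : levelCode U V (ℱ := ℱ) f = levelCode U V g) : f x ≤ g x := by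
  by_contra! hlt
  obtain ⟨b, hgb, hbf⟩ := EReal.lt_iff_exists_rat_btwn.1 hlt
  obtain ⟨a, hba, haf⟩ := EReal.lt_iff_exists_rat_btwn.1 hbf
  have hba' : b < a := by exact_mod_cast hba
  obtain ⟨G, hxG, hS⟩ := exists_separatesLevels hU hV hsep hℱ hx hf hba'
  obtain ⟨S, hS⟩ := exists_levelCode_eq_some hS
  have hfS := separatesLevels_of_levelCode_eq_some hS
  rw [h] at hS
  have hgS := separatesLevels_of_levelCode_eq_some hS
  exact Set.disjoint_left.1 (disjoint_biUnion_biInter_biInter_biUnion hUV S)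
    ((hfS x hxG).1 haf.le) ((hgS x hxG).2 hgb.le)

/-! ### Counting -/

theorem mk_finset_le_of_le {α : Type u} {κ : Cardinal.{u}} (hκ : ℵ₀ ≤ κ) (h : #α ≤ κ) :
    #(Finset α) ≤ κ := by
  rcases finite_or_infinite α with hα | hα
  · exact Cardinal.mk_le_aleph0.trans hκ
  · rwa [Cardinal.mk_finset_of_infinite]

theorem mk_continuousMap_le_networkWeight_pow_nagamiNumber (X : Type u) [TopologicalSpace X]
    [T35Space X] : #(C(X, ℝ)) ≤ networkWeight X ^ nagamiNumber X := by
  obtain ⟨𝒩, h𝒩, h𝒩card⟩ := exists_isNetwork_mk_le X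
  obtain ⟨ℱ, hℱ, hℱsep, hℱcard⟩ := exists_separatesFromRemainder_mk_le X
  have hnw : ℵ₀ ≤ networkWeight X := le_max_left _ _
  have hnag : ℵ₀ ≤ nagamiNumber X := le_max_left _ _
  obtain ⟨U, V, hU, hV, hUV, hsep⟩ := h𝒩.exists_disjoint_open_pairs
    (continuous_stoneCechUnit (α := X)) isDenseEmbedding_stoneCechUnit.injective
  have hsep' : ∀ c ∈ Set.range (stoneCechUnit : X → StoneCech X),
      ∀ d ∈ Set.range (stoneCechUnit : X → StoneCech X), c ≠ d → ∃ p, c ∈ U p ∧ d ∈ V p := by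
    rintro _ ⟨x, rfl⟩ _ ⟨y, rfl⟩ hxy
    exact hsep x y (ne_of_apply_ne _ hxy)
  have hcont (f : C(X, ℝ)) : Continuous fun x => (f x : EReal) :=
    continuous_coe_real_ereal.comp f.continuous
  let code (f : C(X, ℝ)) : Finset ℱ × ℚ × ℚ → Option (Finset (Finset (𝒩 × 𝒩))) :=
    levelCode U V (stoneCechExtend (hcont f))
  have hle (f g : C(X, ℝ)) (h : code f = code g) (x : X) : f x ≤ g x := by
    have := le_of_levelCode_eq hU hV hUV hsep' hℱ (x := stoneCechUnit x)
      (fun y hy => hℱsep x y hy) (continuous_stoneCechExtend (hcont f)) h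
    simpa [stoneCechExtend_stoneCechUnit] using this
  -- Equality of codes is symmetric, so the one-sided estimate suffices.
  have hinj : Function.Injective code := fun f g h =>
    ContinuousMap.ext fun x => le_antisymm (hle f g h x) (hle g f h.symm x)
  have hdom : #(Finset ℱ × ℚ × ℚ) ≤ nagamiNumber X := by
    rw [Cardinal.mk_prod, Cardinal.lift_uzero]
    refine Cardinal.mul_le_of_le hnag (mk_finset_le_of_le hnag hℱcard) ?_
    exact (Cardinal.lift_le_aleph0.2 Cardinal.mk_le_aleph0).trans hnag
  have hcod : #(Option (Finset (Finset (𝒩 × 𝒩)))) ≤ networkWeight X := by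
    rw [Cardinal.mk_option]
    refine Cardinal.add_le_of_le hnw ?_ (Cardinal.one_le_aleph0.trans hnw)
    refine mk_finset_le_of_le hnw (mk_finset_le_of_le hnw ?_)
    rw [Cardinal.mk_prod, Cardinal.lift_id]
    exact Cardinal.mul_le_of_le hnw h𝒩card h𝒩card
  calc #(C(X, ℝ)) ≤ #(Finset ℱ × ℚ × ℚ → Option (Finset (Finset (𝒩 × 𝒩)))) :=
        Cardinal.mk_le_of_injective hinj
    _ = #(Option (Finset (Finset (𝒩 × 𝒩)))) ^ #(Finset ℱ × ℚ × ℚ) := by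
        rw [Cardinal.power_def]
    _ ≤ networkWeight X ^ #(Finset ℱ × ℚ × ℚ) := Cardinal.power_le_power_right hcod
    _ ≤ networkWeight X ^ nagamiNumber X :=
        Cardinal.power_le_power_left (Cardinal.aleph0_pos.trans_le hnw).ne' hdom

theorem theorem1 (X : Type u) [TopologicalSpace X] [T35Space X] [Nonempty X] :
    weight X ≤ #(C(X, ℝ)) ∧ #(C(X, ℝ)) ≤ networkWeight X ^ nagamiNumber X :=
  ⟨weight_le_mk_continuousMap X, mk_continuousMap_le_networkWeight_pow_nagamiNumber X⟩
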